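/- Identify the $n$-qubit Hilbert space $(\mathbb{C}^2)^{\otimes n}$ with $\mathbb{C}^{\mathbb{F}_2^n}$ (computational basis $|x\rangle$, $x\in\mathbb{F}_2^n$). Let $\mathrm{Stab}_n$ be the set of stabilizer states, i.e. of all vectors $$\frac{1}{\sqrt{|A|}}\sum_{x\in A} i^{\ell(x)}(-1)^{Q(x)}|x\rangle,$$ where $A\subseteq\mathbb{F}_2^n$ is a nonempty affine subspace, $\ell:\mathbb{F}_2^n\to\mathbb{F}_2$ is linear and $Q(x)=x^{T}Bx+a^{T}x$ is a quadratic function on $\mathbb{F}_2^n$ (values of $\ell$, $Q$ in the exponents are read in $\{0,1\}$). For a vector $|\psi\rangle$ let $\chi(|\psi\rangle)$ be the least $M>0$ such that $|\psi\rangle=\sum_{i=1}^M c_i|s_i\rangle$ with $c_i\in\mathbb{C}$, $|s_i\rangle\in\mathrm{Stab}_n$, and let $\chi_\delta(|\phi\rangle)=\min\{\chi(|\psi\rangle): \||\phi\rangle-|\psi\rangle\|\le\delta\}$, the minimum being over all vectors $|\psi\rangle$, not necessarily normalized, and $\|\cdot\|$ being the 2-norm. Let $0<\delta<1$. (1) Let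 $n\ge 6$, let $M$ be a positive integer with $1-\delta^2-\frac{M}{2^n}>0$, and let $|\phi\rangle$ be a random $n$-qubit state distributed according to the Haar measure (the unitarily invariant probability measure on the unit sphere). Then $$\Pr[\chi_\delta(|\phi\rangle)\le M]\;\le\; 2\exp\!\left(0.54\,n^2M-\frac{(1-\delta^2-M/2^n)^2\,2^n}{100\pi}\right).$$ (2) For every natural number $n\ge 2\ln\frac{1}{1-\delta^2}+9$ there exists an $n$-qubit state (unit vector) $|\phi\rangle$ with $$\chi_\delta(|\phi\rangle)\;\ge\;\frac{(1-\delta^2)^2\,2^n}{1000\,n^2}.$$ (Since $\ln t\le\log_2 t$ for $t\ge 1$, this also covers the condition with $\log_2$ in place of $\ln$.) -/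

import Mathlib

open MeasureTheory
open scoped Pointwise

noncomputable section

/-- The Hilbert space `(ℂ²)^{⊗n}` of an `n`-qubit system, with its computational basis indexed
by `𝔽₂ⁿ` and the 2-norm. -/
abbrev Qubits (n : ℕ) : Type := EuclideanSpace ℂ (Fin n → ZMod 2)

/-- Quadratic functions `x ↦ xᵀ B x + aᵀ x` on `𝔽₂ⁿ`. -/
def IsQuadraticFn {n : ℕ} (Q : (Fin n → ZMod 2) → ZMod 2) : Prop :=
  ∃ (B : Matrix (Fin n) (Fin n) (ZMod 2)) (a : Fin n → ZMod 2),
    ∀ x, Q x = x ⬝ᵥ (B.mulVec x) + a ⬝ᵥ x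

open Classical in
/-- The vector `|A|^{-1/2} ∑_{x ∈ A} i^{ℓ(x)} (-1)^{Q(x)} |x⟩`; the exponents are the
representatives of `ℓ(x)` and `Q(x)` in `{0, 1}`. -/
def stabVec {n : ℕ} (A : AffineSubspace (ZMod 2) (Fin n → ZMod 2))
    (l : (Fin n → ZMod 2) →ₗ[ZMod 2] ZMod 2) (Q : (Fin n → ZMod 2) → ZMod 2) : Qubits n :=
  WithLp.toLp 2 fun x =>
    if x ∈ A then
      ((1 / Real.sqrt (Set.ncard (A : Set (Fin n → ZMod 2))) : ℝ) : ℂ)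
        * Complex.I ^ (l x).val * (-1 : ℂ) ^ (Q x).val
    else 0

/-- The set of `n`-qubit stabilizer states. -/
def Stab (n : ℕ) : Set (Qubits n) :=
  {s | ∃ (A : AffineSubspace (ZMod 2) (Fin n → ZMod 2))
      (l : (Fin n → ZMod 2) →ₗ[ZMod 2] ZMod 2) (Q : (Fin n → ZMod 2) → ZMod 2),
      (A : Set (Fin n → ZMod 2)).Nonempty ∧ IsQuadraticFn Q ∧ s = stabVec A l Q}

/-- `ψ` is a linear combination of `M` stabilizer states. -/
def IsStabCombination {n : ℕ} (M : ℕ) (ψ : Qubits n) : Prop :=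
  ∃ (c : Fin M → ℂ) (s : Fin M → Qubits n), (∀ i, s i ∈ Stab n) ∧ ψ = ∑ i, c i • s i

/-- The stabilizer rank of a (not necessarily normalized) vector: the least `M > 0` such that it
is a linear combination of `M` stabilizer states. -/
def stabRank {n : ℕ} (ψ : Qubits n) : ℕ :=
  sInf {M : ℕ | 0 < M ∧ IsStabCombination M ψ}

/-- The approximate stabilizer rank: the minimum of the stabilizer rank over all (not necessarily
normalized) vectors at 2-norm distance at most `δ`. -/
def approxStabRank {n : ℕ} (δ : ℝ) (φ : Qubits n) : ℕ :=
  sInf {r : ℕ | ∃ ψ : Qubits n, ‖φ - ψ‖ ≤ δ ∧ r = stabRank ψ}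

/-- The Haar measure on the unit vectors of the `n`-qubit space: the normalized surface measure of
the unit sphere. It is a probability measure and invariant under all unitaries, see below. -/
def haarState (n : ℕ) : Measure (Metric.sphere (0 : Qubits n) 1) :=
  ((volume : Measure (Qubits n)).toSphere Set.univ)⁻¹ • (volume : Measure (Qubits n)).toSphere

instance haarState_isProbabilityMeasure (n : ℕ) : IsProbabilityMeasure (haarState n) := by
  constructor
  have h0 : (volume : Measure (Qubits n)).toSphere Set.univ ≠ 0 := by
    rw [Ne, Measure.measure_univ_eq_zero]
    exact Measure.toSphere_ne_zero _
  simp only [haarState, Measure.smul_apply, smul_eq_mul]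
  exact ENNReal.inv_mul_cancel h0 (measure_ne_top _ _)

/-- The action of a unitary on the unit vectors. -/
def unitaryOnSphere {n : ℕ} (U : Qubits n ≃ₗᵢ[ℂ] Qubits n) (φ : Metric.sphere (0 : Qubits n) 1) :
    Metric.sphere (0 : Qubits n) 1 :=
  ⟨U φ, by simp⟩

theorem haarState_map_unitary {n : ℕ} (U : Qubits n ≃ₗᵢ[ℂ] Qubits n) :
    (haarState n).map (unitaryOnSphere U) = haarState n := by
  have hc : Continuous (unitaryOnSphere U) :=
    (U.continuous.comp continuous_subtype_val).subtype_mk _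
  have hU : MeasurePreserving (U : Qubits n → Qubits n) volume volume := by
    let V : Qubits n ≃ₗᵢ[ℝ] Qubits n :=
      { (U.toLinearEquiv.restrictScalars ℝ) with norm_map' := U.norm_map }
    exact V.measurePreserving
  have key : (volume : Measure (Qubits n)).toSphere.map (unitaryOnSphere U)
      = (volume : Measure (Qubits n)).toSphere := by
    ext s hs
    rw [Measure.map_apply hc.measurable hs, Measure.toSphere_apply' _ hs,
      Measure.toSphere_apply' _ (hc.measurable hs)]
    congr 1
    rw [← hU.measure_preimage_emb U.toHomeomorph.measurableEmbedding
      (Set.Ioo (0 : ℝ) 1 • (Subtype.val '' s))]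
    congr 1
    ext x
    simp only [Set.mem_smul, Set.mem_image, Set.mem_preimage]
    constructor
    · rintro ⟨r, hr, _, ⟨y, hy, rfl⟩, rfl⟩
      refine ⟨r, hr, _, ⟨unitaryOnSphere U y, hy, rfl⟩, ?_⟩
      change r • U y = U ((r : ℝ) • (y : Qubits n))
      exact (LinearMap.map_smul_of_tower U.toLinearEquiv.toLinearMap r (y : Qubits n)).symm
    · rintro ⟨r, hr, _, ⟨y, hy, rfl⟩, hxy⟩
      refine ⟨r, hr, _, ⟨⟨U.symm y, by simp⟩, ?_, rfl⟩, ?_⟩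
      · have : unitaryOnSphere U ⟨U.symm y, by simp⟩ = y := Subtype.ext (by simp [unitaryOnSphere])
        rw [this]; exact hy
      · apply U.injective
        change U ((r : ℝ) • U.symm (y : Qubits n)) = U x
        refine (LinearMap.map_smul_of_tower U.toLinearEquiv.toLinearMap r _).trans ?_
        rw [← hxy]
        simp
  rw [haarState, Measure.map_smul, key]

theorem single_mem_Stab {n : ℕ} (v : Fin n → ZMod 2) :
    EuclideanSpace.single v (1 : ℂ) ∈ Stab n := by
  refine ⟨AffineSubspace.mk' v ⊥, 0, 0, ⟨v, by simp⟩, ⟨0, 0, by simp⟩, ?_⟩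
  have hA : ((AffineSubspace.mk' v ⊥ : AffineSubspace (ZMod 2) (Fin n → ZMod 2)) :
      Set (Fin n → ZMod 2)) = {v} := by
    ext x
    rw [SetLike.mem_coe, AffineSubspace.mem_mk', Submodule.mem_bot, vsub_eq_sub, sub_eq_zero]
    rfl
  ext x
  simp [stabVec, hA, sub_eq_zero]

/-- Every vector is a linear combination of stabilizer states, so the minima that define
`stabRank` and (for `0 ≤ δ`) `approxStabRank` are over nonempty sets of natural numbers. -/
theorem exists_isStabCombination {n : ℕ} (ψ : Qubits n) :
    ∃ M : ℕ, 0 < M ∧ IsStabCombination M ψ := by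
  let e := Fintype.equivFin (Fin n → ZMod 2)
  refine ⟨Fintype.card (Fin n → ZMod 2), Fintype.card_pos, fun i => ψ (e.symm i),
    fun i => EuclideanSpace.single (e.symm i) (1 : ℂ), fun i => single_mem_Stab _, ?_⟩
  rw [e.symm.sum_comp (fun x => ψ x • EuclideanSpace.single x (1 : ℂ))]
  ext y
  simp [Pi.single_apply]

end

open Metric Set Module

/-! If the approximate rank is at most `M`, the state lies within `δ` of the complex span of `M`
stabilizer states, so its component orthogonal to that span has squared norm at most `δ ^ 2`. A Haar
random state has about the fraction `1 - M / 2 ^ n` of its squared norm there; being smaller by `ε =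
1 - δ ^ 2 - M / 2 ^ n` has probability at most `exp (-(2 ^ n * ε ^ 2 / 8))`
(`haarState_close_to_submodule_le`). A union bound over the at most `exp (5 * n ^ 2 * M)` tuples of
codes of stabilizer states gives `haarState_approxStabRank_le`, from which both claims follow.

The concentration bound is a Chernoff argument: polar coordinates turn the spherical measure into a
Gaussian integral, which factors over a subspace and its orthogonal complement. -/

/-! ### Gaussian integrals and polar coordinates -/

/-- Integration in polar coordinates. -/
theorem lintegral_eq_lintegral_toSphere {E : Type*} [NormedAddCommGroup E] [NormedSpace ℝ E]
    [MeasurableSpace E] [BorelSpace E] [FiniteDimensional ℝ E] [Nontrivial E] (μ : Measure E)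
    [μ.IsAddHaarMeasure] {F : E → ENNReal} (hF : Measurable F) :
    ∫⁻ x, F x ∂μ = ∫⁻ u : sphere (0 : E) 1, ∫⁻ r : Ioi (0 : ℝ), F ((r : ℝ) • (u : E))
      ∂Measure.volumeIoiPow (finrank ℝ E - 1) ∂μ.toSphere := by
  have hm : Measurable fun p : sphere (0 : E) 1 × Ioi (0 : ℝ) => F ((p.2 : ℝ) • (p.1 : E)) :=
    hF.comp (by fun_prop)
  rw [← lintegral_prod _ hm.aemeasurable,
    ← (μ.measurePreserving_homeomorphUnitSphereProd).lintegral_comp hm]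
  have h0 : μ.restrict ({0}ᶜ : Set E) = μ := restrict_compl_singleton 0
  conv_lhs => rw [← h0]
  rw [← lintegral_subtype_comap (measurableSet_singleton (0 : E)).compl]
  refine lintegral_congr fun x => ?_
  congr 1
  have hx : ‖(x : E)‖ ≠ 0 := norm_ne_zero_iff.2 x.2
  simp [smul_smul, hx]

theorem lintegral_exp_neg_mul_sq_norm {V : Type*} [NormedAddCommGroup V] [InnerProductSpace ℝ V]
    [FiniteDimensional ℝ V] [MeasurableSpace V] [BorelSpace V] {b : ℝ} (hb : 0 < b) :
    ∫⁻ v : V, ENNReal.ofReal (Real.exp (-b * ‖v‖ ^ 2)) =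
      ENNReal.ofReal ((Real.pi / b) ^ (finrank ℝ V / 2 : ℝ)) := by
  have h := GaussianFourier.integral_rexp_neg_mul_sq_norm (V := V) hb
  have hpos : 0 < (Real.pi / b) ^ (finrank ℝ V / 2 : ℝ) := by positivity
  rw [← h, ofReal_integral_eq_lintegral_ofReal
    (Integrable.of_integral_ne_zero (by rw [h]; exact hpos.ne'))]
  exact Filter.Eventually.of_forall fun _ => (Real.exp_pos _).le

/-! ### Concentration of the projection onto a subspace -/

section Projection

variable {E : Type*} [NormedAddCommGroup E] [InnerProductSpace ℝ E]
  [FiniteDimensional ℝ E] [MeasurableSpace E] [BorelSpace E]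

/-- The orthogonal decomposition preserves volume, so the integral is a product of two Gaussian
integrals. -/
theorem lintegral_exp_neg_orthogonal (W : Submodule ℝ E) {a b : ℝ} (ha : 0 < a) (hb : 0 < b) :
    ∫⁻ x : E, ENNReal.ofReal (Real.exp (-a * ‖W.orthogonalProjectionOnto x‖ ^ 2
        - b * ‖Wᗮ.orthogonalProjectionOnto x‖ ^ 2)) =
      ENNReal.ofReal ((Real.pi / a) ^ (finrank ℝ W / 2 : ℝ)
        * (Real.pi / b) ^ (finrank ℝ Wᗮ / 2 : ℝ)) := by
  have hmp : MeasurePreserving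
      (fun x : E => (W.orthogonalProjectionOnto x, Wᗮ.orthogonalProjectionOnto x))
      volume volume := by
    have := (WithLp.volume_preserving_ofLp W Wᗮ).comp W.orthogonalDecomposition.measurePreserving
    have e : (fun x : E => (W.orthogonalProjectionOnto x, Wᗮ.orthogonalProjectionOnto x))
        = WithLp.ofLp ∘ W.orthogonalDecomposition := by
      funext x
      simp
    rw [e]
    exact this
  have hm : Measurable fun p : W × Wᗮ => ENNReal.ofReal (Real.exp (-a * ‖p.1‖ ^ 2))
      * ENNReal.ofReal (Real.exp (-b * ‖p.2‖ ^ 2)) := by fun_prop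
  have h := hmp.lintegral_comp hm
  rw [Measure.volume_eq_prod,
    lintegral_prod_mul (f := fun y : W => ENNReal.ofReal (Real.exp (-a * ‖y‖ ^ 2)))
      (g := fun z : Wᗮ => ENNReal.ofReal (Real.exp (-b * ‖z‖ ^ 2))) (by fun_prop) (by fun_prop),
    lintegral_exp_neg_mul_sq_norm ha, lintegral_exp_neg_mul_sq_norm hb,
    ← ENNReal.ofReal_mul (by positivity)] at h
  rw [← h]
  refine lintegral_congr fun x => ?_
  rw [← ENNReal.ofReal_mul (Real.exp_pos _).le, ← Real.exp_add]
  congr 2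
  ring

/-- Chernoff bound for the spherical measure of the points close to a subspace. -/
theorem toSphere_close_to_submodule_le [Nontrivial E] (W : Submodule ℝ E) {s l : ℝ}
    (hl : 0 ≤ l) (hls : l * s < 1) (hs1 : s ≤ 1) :
    (volume : Measure E).toSphere {u | ‖Wᗮ.orthogonalProjectionOnto (u : E)‖ ^ 2 ≤ s}
      ≤ ENNReal.ofReal ((1 - l * s) ^ (-(finrank ℝ W / 2 : ℝ))
        * (1 + l * (1 - s)) ^ (-(finrank ℝ Wᗮ / 2 : ℝ)))
        * (volume : Measure E).toSphere univ := by
  set S : Set (sphere (0 : E) 1) := {u | ‖Wᗮ.orthogonalProjectionOnto (u : E)‖ ^ 2 ≤ s} with hS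
  have hSm : MeasurableSet S := measurableSet_le (by fun_prop) measurable_const
  set a := 1 - l * s with ha
  set b := 1 + l * (1 - s) with hb
  have ha0 : 0 < a := by linarith
  have hb0 : 0 < b := by nlinarith
  set R := ∫⁻ r : Ioi (0 : ℝ), ENNReal.ofReal (Real.exp (-1 * (r : ℝ) ^ 2))
      ∂Measure.volumeIoiPow (finrank ℝ E - 1) with hR
  have hnorm : ∀ (r : Ioi (0 : ℝ)) (u : sphere (0 : E) 1), ‖(r : ℝ) • (u : E)‖ = r := by
    intro r u
    rw [norm_smul, Real.norm_of_nonneg r.2.out.le]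
    simp
  have hsplit : ∀ x : E, ‖x‖ ^ 2 = ‖W.orthogonalProjectionOnto x‖ ^ 2
      + ‖Wᗮ.orthogonalProjectionOnto x‖ ^ 2 := fun x => W.norm_sq_eq_add_norm_sq_projection x
  have htot : (volume : Measure E).toSphere univ * R
      = ENNReal.ofReal (Real.pi ^ (finrank ℝ E / 2 : ℝ)) := by
    have h1 := lintegral_exp_neg_mul_sq_norm (V := E) one_pos
    rw [lintegral_eq_lintegral_toSphere _ (by fun_prop), div_one] at h1
    simp only [hnorm] at h1
    rw [← h1, ← hR, lintegral_const, mul_comm]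
  -- With `p`, `q` the squared norms of the two components of `x`, `a * p + b * q = ‖x‖ ^ 2 - l * (s
  -- * ‖x‖ ^ 2 - q)`. On the cone over `S` this is at most `‖x‖ ^ 2`, so the standard Gaussian is
  -- dominated by the anisotropic one.
  have hle : (volume : Measure E).toSphere S * R
      ≤ ENNReal.ofReal ((Real.pi / a) ^ (finrank ℝ W / 2 : ℝ)
        * (Real.pi / b) ^ (finrank ℝ Wᗮ / 2 : ℝ)) := by
    rw [← lintegral_exp_neg_orthogonal W ha0 hb0,
      lintegral_eq_lintegral_toSphere _ (by fun_prop), mul_comm, ← setLIntegral_const]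
    refine (setLIntegral_mono_ae' hSm (Filter.Eventually.of_forall fun u hu => ?_)).trans
      (setLIntegral_le_lintegral S _)
    refine lintegral_mono fun r => ?_
    refine ENNReal.ofReal_le_ofReal (Real.exp_le_exp.2 ?_)
    have h1 := hsplit ((r : ℝ) • (u : E))
    have h2 : ‖Wᗮ.orthogonalProjectionOnto ((r : ℝ) • (u : E))‖ ^ 2 ≤ s * (r : ℝ) ^ 2 := by
      rw [map_smul, norm_smul, mul_pow, Real.norm_of_nonneg r.2.out.le, mul_comm]
      exact mul_le_mul_of_nonneg_right hu (sq_nonneg _)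
    rw [hnorm] at h1
    have h3 := mul_le_mul_of_nonneg_left h2 hl
    rw [eq_sub_of_add_eq h1.symm]
    rw [ha, hb]
    nlinarith
  have hfin : (finrank ℝ E : ℝ) = finrank ℝ W + finrank ℝ Wᗮ := by
    exact_mod_cast (W.finrank_add_finrank_orthogonal).symm
  have hconst : (Real.pi / a) ^ (finrank ℝ W / 2 : ℝ) * (Real.pi / b) ^ (finrank ℝ Wᗮ / 2 : ℝ)
      = (a ^ (-(finrank ℝ W / 2 : ℝ)) * b ^ (-(finrank ℝ Wᗮ / 2 : ℝ)))
        * Real.pi ^ (finrank ℝ E / 2 : ℝ) := by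
    rw [Real.div_rpow Real.pi_pos.le ha0.le, Real.div_rpow Real.pi_pos.le hb0.le, hfin, add_div,
      Real.rpow_add Real.pi_pos, Real.rpow_neg ha0.le, Real.rpow_neg hb0.le]
    field_simp
  rw [hconst, ENNReal.ofReal_mul (by positivity), ← htot, ← mul_assoc] at hle
  have hpi : (0 : ℝ) < Real.pi ^ (finrank ℝ E / 2 : ℝ) := by positivity
  have hR0 : R ≠ 0 := by
    rintro h
    rw [h, mul_zero] at htot
    exact absurd htot.symm (by simpa using hpi)
  have hRtop : R ≠ ⊤ := by
    rintro h
    rw [h, ENNReal.mul_top (Measure.measure_univ_ne_zero.2 (Measure.toSphere_ne_zero _))] at htot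
    exact absurd htot.symm ENNReal.ofReal_ne_top
  exact (ENNReal.mul_le_mul_iff_left hR0 hRtop).1 hle

end Projection

theorem finrank_real_qubits (n : ℕ) : finrank ℝ (Qubits n) = 2 * 2 ^ n := by
  rw [finrank_real_of_complex]
  simp [Fintype.card_pi, ZMod.card]

/-- The exponential rate obtained from the Chernoff bound at a convenient parameter. -/
theorem chernoff_exponent_le {D M k s ε : ℝ} (hkM : k ≤ M) (hs0 : 0 ≤ s)
    (hM : 0 ≤ M) (hD : 0 < D) (hε : 0 < ε) (hεD : D * ε = D * (1 - s) - M) :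
    (1 - ε / 4 * s) ^ (-k) * (1 + ε / 4 * (1 - s)) ^ (-(D - k)) ≤ Real.exp (-(D * ε ^ 2 / 8)) := by
  have hε1 : ε ≤ 1 - s := by
    by_contra! h
    nlinarith [mul_lt_mul_of_pos_left h hD]
  have hMD : M ≤ D := by nlinarith
  set u := ε / 4 * s with hu
  set v := ε / 4 * (1 - s) with hv
  have hu0 : 0 ≤ u := by positivity
  have hv0 : 0 ≤ v := by nlinarith
  have hu1 : u ≤ 1 / 4 := by nlinarith
  have hla : -(u + 2 * u ^ 2) ≤ Real.log (1 - u) := by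
    refine le_trans ?_ (Real.one_sub_inv_le_log_of_pos (by linarith))
    have : (1 - u)⁻¹ ≤ 1 + u + 2 * u ^ 2 := by
      rw [inv_le_iff_one_le_mul₀ (by linarith)]
      nlinarith [mul_nonneg (sq_nonneg u) (by linarith : (0 : ℝ) ≤ 1 - 2 * u)]
    linarith
  have hlb : v - v ^ 2 ≤ Real.log (1 + v) := by
    refine le_trans ?_ (Real.one_sub_inv_le_log_of_pos (by linarith))
    have : (1 + v)⁻¹ ≤ 1 - v + v ^ 2 := by
      rw [inv_le_iff_one_le_mul₀ (by linarith)]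
      nlinarith [pow_nonneg hv0 3]
    linarith
  have hla0 : Real.log (1 - u) ≤ 0 := Real.log_nonpos (by linarith) (by linarith)
  have hlb0 : 0 ≤ Real.log (1 + v) := Real.log_nonneg (by linarith)
  rw [Real.rpow_def_of_pos (by linarith), Real.rpow_def_of_pos (by linarith), ← Real.exp_add]
  refine Real.exp_le_exp.2 ?_
  -- The exponent is nondecreasing in `k`, so the worst case is `k = M`.
  have h1 : Real.log (1 - u) * -k + Real.log (1 + v) * -(D - k)
      ≤ Real.log (1 - u) * -M + Real.log (1 + v) * -(D - M) := by
    nlinarith [mul_nonneg (sub_nonneg.2 hkM) (sub_nonneg.2 (hla0.trans hlb0))]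
  have h2 := mul_le_mul_of_nonneg_right hla hM
  have h3 := mul_le_mul_of_nonneg_right hlb (sub_nonneg.2 hMD)
  -- For a parameter `x`, the linear term is `-x * D * ε` and the quadratic one at most `2 * D * x ^
  -- 2`; `x = ε / 4` minimizes the sum, with value `-(D * ε ^ 2 / 8)`.
  have h4 : (u + 2 * u ^ 2) * M - (v - v ^ 2) * (D - M)
      = -(ε / 4) * (D * ε) + (ε / 4) ^ 2 * (2 * (s ^ 2 * M) + (1 - s) ^ 2 * (D - M)) := by
    rw [hεD, hu, hv]
    ring
  have h5 : s ^ 2 * M ≤ 1 * M := mul_le_mul_of_nonneg_right (by nlinarith) hM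
  have h6 : (1 - s) ^ 2 * (D - M) ≤ 1 * (D - M) :=
    mul_le_mul_of_nonneg_right (by nlinarith) (sub_nonneg.2 hMD)
  have h7 : (ε / 4) ^ 2 * (2 * (s ^ 2 * M) + (1 - s) ^ 2 * (D - M)) ≤ (ε / 4) ^ 2 * (2 * D) :=
    mul_le_mul_of_nonneg_left (by linarith) (sq_nonneg _)
  linarith

theorem haarState_close_to_submodule_le {n M : ℕ} (W : Submodule ℝ (Qubits n))
    (hW : finrank ℝ W ≤ 2 * M) {s : ℝ} (hs0 : 0 ≤ s)
    (hε : 0 < 1 - s - (M : ℝ) / 2 ^ n) :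
    haarState n {u | ‖Wᗮ.orthogonalProjectionOnto (u : Qubits n)‖ ^ 2 ≤ s}
      ≤ ENNReal.ofReal (Real.exp (-(2 ^ n * (1 - s - (M : ℝ) / 2 ^ n) ^ 2 / 8))) := by
  set ε := 1 - s - (M : ℝ) / 2 ^ n with hεdef
  have hMD : 0 ≤ (M : ℝ) / 2 ^ n := by positivity
  have hs1 : s ≤ 1 := by linarith
  have hls : ε / 4 * s < 1 := by nlinarith
  have h := toSphere_close_to_submodule_le W (by positivity : 0 ≤ ε / 4) hls hs1
  have hfin : (finrank ℝ Wᗮ / 2 : ℝ) = 2 ^ n - finrank ℝ W / 2 := by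
    have h1 := W.finrank_add_finrank_orthogonal
    rw [finrank_real_qubits] at h1
    have h2 : (finrank ℝ W + finrank ℝ Wᗮ : ℝ) = 2 * 2 ^ n := by exact_mod_cast h1
    linarith
  have hkM : (finrank ℝ W / 2 : ℝ) ≤ M := by
    have : (finrank ℝ W : ℝ) ≤ 2 * M := by exact_mod_cast hW
    linarith
  rw [hfin] at h
  have hc := chernoff_exponent_le (D := 2 ^ n) hkM hs0 (Nat.cast_nonneg M) (by positivity) hε
    (by rw [hεdef]; field_simp)
  have h0 : (volume : Measure (Qubits n)).toSphere univ ≠ 0 :=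
    Measure.measure_univ_ne_zero.2 (Measure.toSphere_ne_zero _)
  rw [haarState, Measure.smul_apply, smul_eq_mul]
  refine (mul_le_mul_right (h.trans (mul_le_mul_left (ENNReal.ofReal_le_ofReal hc) _)) _).trans ?_
  rw [mul_left_comm, ENNReal.inv_mul_cancel h0 (measure_ne_top _ _), mul_one]

/-! ### Counting stabilizer states -/

/-- Data describing a stabilizer state: a base point and a matrix whose range is the direction of
the affine subspace, the linear form, and the quadratic function. -/
abbrev StabCode (n : ℕ) : Type :=
  (Fin n → ZMod 2) × Matrix (Fin n) (Fin n) (ZMod 2) × (Fin n → ZMod 2)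
    × Matrix (Fin n) (Fin n) (ZMod 2) × (Fin n → ZMod 2)

/-- The stabilizer state described by a code. -/
noncomputable def StabCode.vec {n : ℕ} (c : StabCode n) : Qubits n :=
  stabVec (AffineSubspace.mk' c.1 (LinearMap.range (Matrix.toLin' c.2.1)))
    (dotProductEquiv (ZMod 2) (Fin n) c.2.2.1)
    (fun x => x ⬝ᵥ (c.2.2.2.1.mulVec x) + c.2.2.2.2 ⬝ᵥ x)

theorem card_stabCode (n : ℕ) : Fintype.card (StabCode n) = 2 ^ (2 * n ^ 2 + 3 * n) := by
  have hm : Nat.card (Matrix (Fin n) (Fin n) (ZMod 2)) = 2 ^ (n * n) := by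
    rw [show Matrix (Fin n) (Fin n) (ZMod 2) = (Fin n → Fin n → ZMod 2) from rfl]
    simp [← pow_mul]
  have hv : Nat.card (Fin n → ZMod 2) = 2 ^ n := by simp
  rw [← Nat.card_eq_fintype_card, StabCode]
  simp only [Nat.card_prod, hm, hv, ← pow_add]
  congr 1
  ring

/-- Every subspace is the range of a square matrix, namely of a projection onto it. Codes may repeat
states, which is harmless for an upper count. -/
theorem exists_stabCode {n : ℕ} {s : Qubits n} (hs : s ∈ Stab n) : ∃ c : StabCode n, c.vec = s := by
  obtain ⟨A, l, Q, ⟨p, hp⟩, ⟨B, a, hQ⟩, rfl⟩ := hs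
  obtain ⟨g, hg⟩ := A.direction.subtype.exists_leftInverse_of_injective
    (LinearMap.ker_eq_bot.2 A.direction.injective_subtype)
  have hrange : LinearMap.range (A.direction.subtype ∘ₗ g) = A.direction := by
    rw [LinearMap.range_comp_of_range_eq_top, Submodule.range_subtype]
    exact LinearMap.range_eq_top.2 fun y => ⟨y, LinearMap.congr_fun hg y⟩
  refine ⟨(p, LinearMap.toMatrix' (A.direction.subtype ∘ₗ g),
    (dotProductEquiv (ZMod 2) (Fin n)).symm l, B, a), ?_⟩
  rw [StabCode.vec, Matrix.toLin'_toMatrix', hrange, AffineSubspace.mk'_eq hp,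
    LinearEquiv.apply_symm_apply, ← funext hQ]

/-- The real subspace underlying the complex span of the vectors given by some codes. -/
noncomputable def codeSpan {n M : ℕ} (f : Fin M → StabCode n) : Submodule ℝ (Qubits n) :=
  (Submodule.span ℂ (range fun i => (f i).vec)).restrictScalars ℝ

theorem finrank_codeSpan_le {n M : ℕ} (f : Fin M → StabCode n) :
    finrank ℝ (codeSpan f) ≤ 2 * M := by
  have h1 : finrank ℝ (codeSpan f)
      = 2 * finrank ℂ (Submodule.span ℂ (range fun i => (f i).vec)) :=
    finrank_real_of_complex (Submodule.span ℂ (range fun i => (f i).vec))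
  have h2 := finrank_range_le_card (R := ℂ) (fun i => (f i).vec)
  rw [Fintype.card_fin] at h2
  rw [h1]
  exact Nat.mul_le_mul_left 2 h2

theorem stabRank_spec {n : ℕ} (ψ : Qubits n) :
    0 < stabRank ψ ∧ IsStabCombination (stabRank ψ) ψ :=
  Nat.sInf_mem (exists_isStabCombination ψ)

theorem approxStabRank_spec {n : ℕ} {δ : ℝ} (hδ : 0 ≤ δ) (φ : Qubits n) :
    ∃ ψ : Qubits n, ‖φ - ψ‖ ≤ δ ∧ approxStabRank δ φ = stabRank ψ :=
  Nat.sInf_mem (s := {r : ℕ | ∃ ψ : Qubits n, ‖φ - ψ‖ ≤ δ ∧ r = stabRank ψ})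
    ⟨_, φ, by simpa using hδ, rfl⟩

theorem exists_codeSpan_of_stabRank_le {n M : ℕ} {ψ : Qubits n} (h : stabRank ψ ≤ M) :
    ∃ f : Fin M → StabCode n, ψ ∈ codeSpan f := by
  obtain ⟨-, c, s, hs, hψ⟩ := stabRank_spec ψ
  choose g hg using fun i => exists_stabCode (hs i)
  -- Padding by the arbitrary code `0` only enlarges the span.
  refine ⟨fun j => if hj : (j : ℕ) < stabRank ψ then g ⟨j, hj⟩ else 0, ?_⟩
  change ψ ∈ Submodule.span ℂ _
  refine (congrArg (· ∈ Submodule.span ℂ _) hψ).mpr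
    (Submodule.sum_mem _ fun i _ => Submodule.smul_mem _ _ (Submodule.subset_span ?_))
  refine ⟨⟨i, i.2.trans_le h⟩, ?_⟩
  simp [hg]

theorem approxStabRank_le_subset {n : ℕ} {δ : ℝ} (hδ : 0 ≤ δ) (M : ℕ) :
    {φ : sphere (0 : Qubits n) 1 | approxStabRank δ (φ : Qubits n) ≤ M} ⊆
      ⋃ f : Fin M → StabCode n,
        {u | ‖(codeSpan f)ᗮ.orthogonalProjectionOnto (u : Qubits n)‖ ^ 2 ≤ δ ^ 2} := by
  intro φ hφ
  obtain ⟨ψ, hψ, hr⟩ := approxStabRank_spec hδ (φ : Qubits n)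
  obtain ⟨f, hf⟩ := exists_codeSpan_of_stabRank_le (hr.symm.trans_le hφ)
  refine mem_iUnion.2 ⟨f, ?_⟩
  have h0 : (codeSpan f)ᗮ.orthogonalProjectionOnto ψ = 0 :=
    Submodule.orthogonalProjectionOnto_orthogonal_apply_eq_zero hf
  have h1 := (codeSpan f)ᗮ.norm_orthogonalProjectionOnto_apply_le ((φ : Qubits n) - ψ)
  rw [map_sub, h0, sub_zero] at h1
  exact pow_le_pow_left₀ (norm_nonneg _) (h1.trans hψ) 2

/-! ### Union bound and conclusion -/

/-- The union bound over all tuples of stabilizer states. -/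
theorem haarState_approxStabRank_le {n : ℕ} (hn : 1 ≤ n) {δ : ℝ} (hδ : 0 ≤ δ) {M : ℕ}
    (hε : 0 < 1 - δ ^ 2 - (M : ℝ) / 2 ^ n) :
    (haarState n).real {φ | approxStabRank δ (φ : Qubits n) ≤ M} ≤
      Real.exp (5 * (n : ℝ) ^ 2 * M - (1 - δ ^ 2 - (M : ℝ) / 2 ^ n) ^ 2 * 2 ^ n / 8) := by
  set T := Real.exp (-(2 ^ n * (1 - δ ^ 2 - (M : ℝ) / 2 ^ n) ^ 2 / 8)) with hT
  have h1 : (haarState n).real {φ | approxStabRank δ (φ : Qubits n) ≤ M} ≤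
      ∑ f : Fin M → StabCode n, (haarState n).real
        {u | ‖(codeSpan f)ᗮ.orthogonalProjectionOnto (u : Qubits n)‖ ^ 2 ≤ δ ^ 2} :=
    (measureReal_mono (approxStabRank_le_subset hδ M)).trans (measureReal_iUnion_fintype_le _)
  have h2 : ∀ f ∈ (Finset.univ : Finset (Fin M → StabCode n)), (haarState n).real
      {u | ‖(codeSpan f)ᗮ.orthogonalProjectionOnto (u : Qubits n)‖ ^ 2 ≤ δ ^ 2} ≤ T := by
    intro f _
    exact ENNReal.toReal_le_of_le_ofReal (Real.exp_pos _).le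
      (haarState_close_to_submodule_le _ (finrank_codeSpan_le f) (sq_nonneg δ) hε)
  refine (h1.trans (Finset.sum_le_card_nsmul _ _ _ h2)).trans ?_
  have hcard : (Fintype.card (Fin M → StabCode n) : ℝ) ≤ Real.exp (5 * (n : ℝ) ^ 2 * M) := by
    rw [Fintype.card_fun, Fintype.card_fin, card_stabCode, ← pow_mul]
    have h3 : (2 * n ^ 2 + 3 * n) * M ≤ 5 * n ^ 2 * M := by
      refine Nat.mul_le_mul_right M ?_
      nlinarith
    have h4 : (2 : ℝ) ≤ Real.exp 1 := by linarith [Real.add_one_le_exp (1 : ℝ)]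
    calc (((2 : ℕ) ^ ((2 * n ^ 2 + 3 * n) * M) : ℕ) : ℝ)
        ≤ 2 ^ (5 * n ^ 2 * M) := by
          push_cast
          exact pow_le_pow_right₀ one_le_two h3
      _ ≤ Real.exp 1 ^ (5 * n ^ 2 * M) := pow_le_pow_left₀ zero_le_two h4 _
      _ = Real.exp (5 * (n : ℝ) ^ 2 * M) := by
          rw [← Real.exp_nat_mul]
          push_cast
          rw [mul_one]
  rw [Finset.card_univ, nsmul_eq_mul, sub_eq_add_neg, Real.exp_add, mul_comm _ ((2 : ℝ) ^ n)]
  exact mul_le_mul_of_nonneg_right hcard (Real.exp_pos _).le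

theorem mainTheorem2 (n : ℕ) (δ : ℝ) (hδ0 : 0 < δ) (hδ1 : δ < 1) :
    (6 ≤ n → ∀ M : ℕ, 0 < M → 0 < 1 - δ ^ 2 - (M : ℝ) / 2 ^ n →
      (haarState n).real {φ | approxStabRank δ (φ : Qubits n) ≤ M} ≤
        2 * Real.exp (0.54 * (n : ℝ) ^ 2 * M
          - (1 - δ ^ 2 - (M : ℝ) / 2 ^ n) ^ 2 * 2 ^ n / (100 * Real.pi))) ∧
    (2 * Real.log (1 / (1 - δ ^ 2)) + 9 ≤ (n : ℝ) →
      ∃ φ : Qubits n, ‖φ‖ = 1 ∧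
        (1 - δ ^ 2) ^ 2 * 2 ^ n / (1000 * (n : ℝ) ^ 2) ≤ (approxStabRank δ φ : ℝ)) := by
  have ht : 0 < 1 - δ ^ 2 := by nlinarith
  constructor
  · intro hn M _ hε
    set X := (1 - δ ^ 2 - (M : ℝ) / 2 ^ n) ^ 2 * 2 ^ n with hX
    have hX0 : 0 ≤ X := by positivity
    have hnM : 0 ≤ (n : ℝ) ^ 2 * M := by positivity
    -- A nonnegative exponent makes the claim trivial. A negative one forces `n ^ 2 * M < X / 162`,
    -- and then `5 * n ^ 2 * M - X / 8` is below the claimed exponent despite the larger constant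
    -- `5`.
    rcases le_or_gt 0 (0.54 * (n : ℝ) ^ 2 * M - X / (100 * Real.pi)) with h | h
    · have h1 : (haarState n).real {φ | approxStabRank δ (φ : Qubits n) ≤ M} ≤ 1 :=
        measureReal_le_one
      linarith [Real.one_le_exp h]
    · refine (haarState_approxStabRank_le (by omega) hδ0.le hε).trans ?_
      rw [← hX]
      have h2 : X / (100 * Real.pi) ≤ X / 300 :=
        div_le_div_of_nonneg_left hX0 (by norm_num) (by linarith [Real.pi_gt_three])
      refine (Real.exp_le_exp.2 ?_).trans (le_mul_of_one_le_left (Real.exp_pos _).le one_le_two)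
      linarith
  · intro hn
    have hlog : 0 ≤ Real.log (1 / (1 - δ ^ 2)) :=
      Real.log_nonneg ((one_le_div ht).2 (by nlinarith))
    have hn1 : (1 : ℝ) ≤ n := by linarith
    have hn1' : 1 ≤ n := by exact_mod_cast hn1
    by_contra! hcon
    set t := 1 - δ ^ 2 with ht_def
    set b := t ^ 2 * 2 ^ n / (1000 * (n : ℝ) ^ 2) with hb
    have hb0 : 0 < b := by positivity
    -- The largest natural number below `b`: for a rank, `< b` and `≤ M` are the same. It may be
    -- `0`.
    set M := ⌈b⌉₊ - 1 with hM
    have hceil : 1 ≤ ⌈b⌉₊ := Nat.ceil_pos.2 hb0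
    have hMb : (M : ℝ) < b := by
      rw [← Nat.lt_ceil]
      omega
    have hall : {φ : sphere (0 : Qubits n) 1 | approxStabRank δ (φ : Qubits n) ≤ M} = univ := by
      refine eq_univ_of_forall fun φ => ?_
      have := Nat.lt_ceil.2 (hcon φ (by simp))
      change _ ≤ M
      omega
    have hbX : b * (1000 * (n : ℝ) ^ 2) = t ^ 2 * 2 ^ n := by
      rw [hb]
      field_simp
    have hn2 : (1 : ℝ) ≤ (n : ℝ) ^ 2 := one_le_pow₀ hn1
    have hbt : b ≤ t / 1000 * 2 ^ n := by
      have hp : (0 : ℝ) < 2 ^ n := by positivity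
      have h1 : t ^ 2 ≤ t := by nlinarith
      nlinarith [mul_le_mul_of_nonneg_right h1 hp.le, mul_le_mul_of_nonneg_left hn2 hb0.le]
    have hMt : (M : ℝ) / 2 ^ n ≤ t / 1000 := by
      rw [div_le_iff₀ (by positivity)]
      linarith
    have hε : 0 < t - (M : ℝ) / 2 ^ n := by linarith
    have h := haarState_approxStabRank_le hn1' hδ0.le hε
    rw [hall, probReal_univ, Real.one_le_exp_iff, ← ht_def] at h
    -- The event has probability `1`, so the exponent must be nonnegative; yet it is at most `t ^ 2
    -- * 2 ^ n * (1 / 200 - 1 / 32)`.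
    have h1 : (t / 2) ^ 2 * 2 ^ n ≤ (t - (M : ℝ) / 2 ^ n) ^ 2 * 2 ^ n := by
      gcongr
      linarith
    have h2 : 5 * (n : ℝ) ^ 2 * M ≤ 5 * (n : ℝ) ^ 2 * b := by gcongr
    have h3 : 0 < t ^ 2 * 2 ^ n := by positivity
    nlinarith
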